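/- Let $X$ be a real random variable with the standard Cauchy distribution, i.e. with density $\frac{1}{\pi(1+x^2)}$ on $\mathbb{R}$. For $t\ge 0$ let $\xi(t)=\ln(1+\sqrt{t})+\tfrac12\ln(1+t)$, for $\lambda>0$ let $\mu(\lambda)=\mathbb{E}\,\xi(\lambda|X|)$, and for $\nu>0$ let $$h(\nu)=\frac{\pi}{2}+\arctan\left(\frac{\nu}{\sqrt2}-\frac{1}{\nu\sqrt2}\right),\qquad\text{so that}\qquad h(\sqrt\lambda)=\frac{\pi}{2}+\arctan\left(\frac{\sqrt\lambda}{\sqrt2}-\frac{1}{\sqrt{2\lambda}}\right).$$ Then for every $\lambda>0$ all expectations below, as well as the one defining $\mu(\lambda)$, are finite, and $$\mathbb{E}\left(2\ln^2\bigl(1+\sqrt{\lambda|X|}\bigr)+\tfrac12\ln^2(1+\lambda|X|)\right)=2\,\mathbb{E}\arctan^2\bigl(\sqrt{\lambda|X|}\bigr)+\mu(\lambda)^2-\arctan^2(\lambda)+2\arctan(\lambda)\,h(\sqrt\lambda)-h(\sqrt\lambda)^2 .$$ -/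

import Mathlib

open MeasureTheory ProbabilityTheory

/-- The function `ξ(t) = ln(1 + √t) + (1/2) ln(1 + t)`, used for `t ≥ 0`. -/
noncomputable def xi (t : ℝ) : ℝ :=
  Real.log (1 + Real.sqrt t) + 1 / 2 * Real.log (1 + t)

/-- The first moment `μ(lam) = E ξ(lam |X|)` of a real random variable `X`. -/
noncomputable def xiMean {Ω : Type*} [MeasurableSpace Ω] (P : Measure Ω) (X : Ω → ℝ)
    (lam : ℝ) : ℝ :=
  ∫ ω, xi (lam * |X ω|) ∂P

/-- The function `h(ν) = π/2 + arctan(ν/√2 - 1/(ν√2))`, used for `ν > 0`. -/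
noncomputable def hFun (ν : ℝ) : ℝ :=
  Real.pi / 2 + Real.arctan (ν / Real.sqrt 2 - 1 / (ν * Real.sqrt 2))

/-! Let `ζ = exp(iπ/4)`. Under `|x| = u²` the Cauchy weight becomes a multiple of `2u du/(u⁴+1)`,
and `2w/(w⁴+1)` has `ζ` as its only pole in the closed first quadrant. Since `i·2(iu) = -2u`,
shifting the contour from one axis to the other gives, for `H` holomorphic on the quadrant with at
most linear growth, `E[Re H(√|X|) + Re H(i√|X|)] = 2 Re H(ζ)` (`integral_cauchyMeasure_re_add_re`).
Take `c = √λ`, `L(w) = log(1 + cw)`. `H = L` gives `μ(λ) = 2 Re L(ζ)`; `H = L²` gives `E(ln² + ¼ ln²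
- arctan²) = 2(Re L(ζ))² - 2(Im L(ζ))²`. Doubling and inserting `2 Im L(ζ) = h(c) - arctan λ` yields
the identity. -/

/-- The closed first quadrant of the complex plane. -/
def closedQuadrant : Set ℂ := {w | 0 ≤ w.re ∧ 0 ≤ w.im}

theorem ofReal_mem_closedQuadrant {x : ℝ} (hx : 0 ≤ x) : (x : ℂ) ∈ closedQuadrant := by
  simp [closedQuadrant, hx]

theorem ofReal_mul_I_mem_closedQuadrant {x : ℝ} (hx : 0 ≤ x) :
    (x : ℂ) * Complex.I ∈ closedQuadrant := by
  simp [closedQuadrant, hx]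

/-! ### Contour integration over the quadrant -/

theorem integrableOn_Ioi_of_norm_le_div_sq {f : ℝ → ℂ} (hf : ContinuousOn f (Set.Ici 0)) {M : ℝ}
    (hM : ∀ x, 2 ≤ x → ‖f x‖ ≤ M / x ^ 2) : IntegrableOn f (Set.Ioi 0) := by
  rw [← Set.Ioc_union_Ioi_eq_Ioi (show (0 : ℝ) ≤ 2 by norm_num)]
  refine IntegrableOn.union ?_ ?_
  · exact ((hf.mono Set.Icc_subset_Ici_self).integrableOn_Icc).mono_set Set.Ioc_subset_Icc_self
  · have h := (integrableOn_Ioi_rpow_of_lt (show (-2 : ℝ) < -1 by norm_num)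
      (show (0 : ℝ) < 2 by norm_num)).const_mul M
    refine Integrable.mono' h ((hf.mono ?_).aestronglyMeasurable measurableSet_Ioi) ?_
    · intro x hx
      simp only [Set.mem_Ioi, Set.mem_Ici] at *
      linarith
    · filter_upwards [ae_restrict_mem measurableSet_Ioi] with x hx
      have hx' : (2 : ℝ) < x := hx
      refine (hM x hx'.le).trans_eq ?_
      rw [Real.rpow_neg (by linarith), div_eq_mul_inv]
      norm_num

/-- Cauchy's theorem on the squares `[0,R]²`: the two far sides have length `R` and `g` is at most
`M/R²` there, so they vanish as `R → ∞`. -/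
theorem integral_axes_eq_of_norm_le_div_sq {g : ℂ → ℂ} (hg : DifferentiableOn ℂ g closedQuadrant)
    {M : ℝ} (hM : ∀ w ∈ closedQuadrant, 2 ≤ ‖w‖ → ‖g w‖ ≤ M / ‖w‖ ^ 2) :
    IntegrableOn (fun x : ℝ => g x) (Set.Ioi 0) ∧
    IntegrableOn (fun y : ℝ => g (y * Complex.I)) (Set.Ioi 0) ∧
    ∫ x in Set.Ioi (0 : ℝ), g x = Complex.I * ∫ y in Set.Ioi (0 : ℝ), g (y * Complex.I) := by
  have h1 : IntegrableOn (fun x : ℝ => g x) (Set.Ioi 0) := by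
    refine integrableOn_Ioi_of_norm_le_div_sq (M := M) (hg.continuousOn.comp (by fun_prop)
      fun x hx => ofReal_mem_closedQuadrant hx) fun x hx => ?_
    have h0 : (0 : ℝ) ≤ x := by linarith
    have := hM x (ofReal_mem_closedQuadrant h0)
    rw [Complex.norm_real, Real.norm_of_nonneg h0] at this
    exact this hx
  have h2 : IntegrableOn (fun y : ℝ => g (y * Complex.I)) (Set.Ioi 0) := by
    refine integrableOn_Ioi_of_norm_le_div_sq (M := M) (hg.continuousOn.comp (by fun_prop)
      fun x hx => ofReal_mul_I_mem_closedQuadrant hx) fun x hx => ?_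
    have h0 : (0 : ℝ) ≤ x := by linarith
    have := hM _ (ofReal_mul_I_mem_closedQuadrant h0)
    rw [norm_mul, Complex.norm_I, mul_one, Complex.norm_real, Real.norm_of_nonneg h0] at this
    exact this hx
  refine ⟨h1, h2, ?_⟩
  have t1 := intervalIntegral_tendsto_integral_Ioi 0 h1 Filter.tendsto_id
  have t2 := intervalIntegral_tendsto_integral_Ioi 0 h2 Filter.tendsto_id
  have side : ∀ k : ℝ → ℝ → ℂ, (∀ R, 2 ≤ R → ∀ y, 0 ≤ y → k R y ∈ closedQuadrant ∧ R ≤ ‖k R y‖) →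
      Filter.Tendsto (fun R : ℝ => ∫ y in (0 : ℝ)..R, g (k R y)) Filter.atTop (nhds 0) := by
    intro k hk
    have hM0 : 0 ≤ M := by
      have := (norm_nonneg _).trans (hM 2 (by simp [closedQuadrant]) (by simp))
      norm_num at this
      linarith
    refine squeeze_zero_norm' (a := fun R => M / R) ?_ (Filter.tendsto_id.const_div_atTop M)
    filter_upwards [Filter.eventually_ge_atTop 2] with R hR
    have := intervalIntegral.norm_integral_le_of_norm_le_const (a := 0) (b := R)
      (f := fun y => g (k R y)) (C := M / R ^ 2) (fun y hy => by
        rw [Set.uIoc_of_le (by linarith)] at hy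
        obtain ⟨hq, hn⟩ := hk R hR y hy.1.le
        refine (hM _ hq (hR.trans hn)).trans ?_
        gcongr)
    refine this.trans_eq ?_
    rw [sub_zero, abs_of_nonneg (by linarith)]
    field_simp
  have s1 := side (fun R y => y + R * Complex.I) (fun R hR y hy => by
    refine ⟨by simp [closedQuadrant]; constructor <;> linarith, ?_⟩
    have := Complex.abs_im_le_norm ((y : ℂ) + R * Complex.I)
    simp at this
    exact (le_abs_self R).trans this)
  have s2 := side (fun R y => R + y * Complex.I) (fun R hR y hy => by
    refine ⟨by simp [closedQuadrant]; constructor <;> linarith, ?_⟩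
    have := Complex.abs_re_le_norm ((R : ℂ) + y * Complex.I)
    simp at this
    exact (le_abs_self R).trans this)
  have t := ((t1.sub s1).add (s2.const_mul Complex.I)).sub (t2.const_mul Complex.I)
  have t0 := t.congr' (f₂ := fun _ => 0) (by
    filter_upwards [Filter.eventually_ge_atTop 0] with R hR
    have := Complex.integral_boundary_rect_eq_zero_of_differentiableOn g 0 (R + R * Complex.I)
      (hg.mono (by
        intro w hw
        rw [Complex.mem_reProdIm] at hw
        simp [Set.uIcc_of_le hR] at hw
        exact ⟨hw.1.1, hw.2.1⟩))
    simpa using this)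
  have := tendsto_nhds_unique t0 tendsto_const_nhds
  simp only [sub_zero, mul_zero, add_zero] at this
  exact sub_eq_zero.1 this

/-! ### Integration against the Cauchy law -/

theorem cauchyPDFReal_zero_one (x : ℝ) : cauchyPDFReal 0 1 x = Real.pi⁻¹ * (1 + x ^ 2)⁻¹ := by
  simp [cauchyPDFReal_def']

theorem integral_cauchyMeasure (f : ℝ → ℝ) :
    ∫ x, f x ∂(cauchyMeasure 0 1) = Real.pi⁻¹ * ∫ x, f x / (1 + x ^ 2) := by
  rw [cauchyMeasure_of_scale_ne_zero 0 one_ne_zero,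
    integral_withDensity_eq_integral_toReal_smul (by fun_prop)
      (Filter.Eventually.of_forall fun x => by simp [cauchyPDF]), ← integral_const_mul]
  congr 1 with x
  rw [cauchyPDF, ENNReal.toReal_ofReal (cauchyPDF_pos 0 one_ne_zero x).le, cauchyPDFReal_zero_one,
    smul_eq_mul]
  field_simp

theorem integral_cauchyMeasure_comp_abs (f : ℝ → ℝ) :
    ∫ x, f |x| ∂(cauchyMeasure 0 1) =
      2 * Real.pi⁻¹ * ∫ u in Set.Ioi (0 : ℝ), f (u ^ 2) * (2 * u) / (u ^ 4 + 1) := by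
  rw [integral_cauchyMeasure]
  have h1 := integral_comp_abs (f := fun x => f x / (1 + x ^ 2))
  simp only [sq_abs] at h1
  rw [h1, ← integral_comp_rpow_Ioi (fun x => f x / (1 + x ^ 2)) (two_ne_zero (α := ℝ)),
    ← mul_assoc, mul_comm Real.pi⁻¹]
  congr 1
  refine setIntegral_congr_fun measurableSet_Ioi fun u _ => ?_
  norm_num
  ring

theorem integrable_cauchyMeasure_of_abs_le {f : ℝ → ℝ} (hf : Measurable f) {C : ℝ}
    (hC : ∀ x, |f x| ≤ C * (1 + Real.sqrt |x|)) : Integrable f (cauchyMeasure 0 1) := by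
  have hC0 : 0 ≤ C := by simpa using (abs_nonneg _).trans (hC 0)
  rw [cauchyMeasure_of_scale_ne_zero 0 one_ne_zero,
    integrable_withDensity_iff_integrable_smul' (by fun_prop)
      (Filter.Eventually.of_forall fun x => by simp [cauchyPDF])]
  -- The integrand decays like `√|x|/x²`, hence the exponent `3/2`.
  have h := (integrable_rpow_neg_one_add_norm_sq (E := ℝ) (μ := volume) (r := 3 / 2)
    (by norm_num)).const_mul (2 * C)
  refine h.mono' (by fun_prop) (Filter.Eventually.of_forall fun x => ?_)
  rw [cauchyPDF, ENNReal.toReal_ofReal (cauchyPDF_pos 0 one_ne_zero x).le, cauchyPDFReal_zero_one,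
    smul_eq_mul, norm_mul, Real.norm_eq_abs (f x), Real.norm_of_nonneg (by positivity),
    Real.norm_eq_abs, sq_abs]
  have hs : (1 : ℝ) ≤ 1 + x ^ 2 := by nlinarith [sq_nonneg x]
  have e : (1 + x ^ 2) ^ (-(3 / 2 : ℝ) / 2) = (1 + x ^ 2)⁻¹ * (1 + x ^ 2) ^ (1 / 4 : ℝ) := by
    rw [← Real.rpow_neg_one, ← Real.rpow_add (by linarith)]
    norm_num
  have hq : Real.sqrt |x| ≤ (1 + x ^ 2) ^ (1 / 4 : ℝ) := by
    have : Real.sqrt |x| = (x ^ 2) ^ (1 / 4 : ℝ) := by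
      rw [← sq_abs, ← Real.rpow_natCast, ← Real.rpow_mul (abs_nonneg x), Real.sqrt_eq_rpow]
      norm_num
    rw [this]
    gcongr
    linarith
  have h1 : 1 ≤ (1 + x ^ 2) ^ (1 / 4 : ℝ) := Real.one_le_rpow hs (by norm_num)
  have hpi : Real.pi⁻¹ ≤ 1 := inv_le_one_of_one_le₀ (by linarith [Real.pi_gt_three])
  have hb : |f x| ≤ 2 * C * (1 + x ^ 2) ^ (1 / 4 : ℝ) := by
    refine (hC x).trans ?_
    nlinarith
  rw [e]
  calc Real.pi⁻¹ * (1 + x ^ 2)⁻¹ * |f x|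
      ≤ 1 * (1 + x ^ 2)⁻¹ * (2 * C * (1 + x ^ 2) ^ (1 / 4 : ℝ)) := by gcongr
    _ = _ := by ring

/-! ### Removing the pole: the evaluation formula at `ζ` -/

/-- The primitive eighth root of unity `exp (iπ/4)`. -/
noncomputable def eighthRoot : ℂ := ⟨(Real.sqrt 2)⁻¹, (Real.sqrt 2)⁻¹⟩

theorem eighthRoot_sq : eighthRoot ^ 2 = Complex.I := by
  have h : (Real.sqrt 2)⁻¹ * (Real.sqrt 2)⁻¹ = 1 / 2 := by
    rw [← mul_inv, Real.mul_self_sqrt (by norm_num)]; norm_num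
  rw [sq]
  apply Complex.ext <;> simp [eighthRoot, h]
  norm_num

theorem eighthRoot_re_pos : 0 < eighthRoot.re := by simp [eighthRoot]

theorem eighthRoot_im_pos : 0 < eighthRoot.im := by simp [eighthRoot]

theorem closedQuadrant_mem_nhds_eighthRoot : closedQuadrant ∈ nhds eighthRoot := by
  have h1 : ∀ᶠ w : ℂ in nhds eighthRoot, 0 < w.re :=
    Complex.continuous_re.continuousAt.eventually_const_lt eighthRoot_re_pos
  have h2 : ∀ᶠ w : ℂ in nhds eighthRoot, 0 < w.im :=
    Complex.continuous_im.continuousAt.eventually_const_lt eighthRoot_im_pos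
  filter_upwards [h1, h2] with w h h'
  exact ⟨h.le, h'.le⟩

theorem add_eighthRoot_ne_zero {w : ℂ} (hw : w ∈ closedQuadrant) : w + eighthRoot ≠ 0 := by
  intro h
  have := congrArg Complex.re h
  simp only [Complex.add_re, Complex.zero_re] at this
  linarith [hw.1, eighthRoot_re_pos]

theorem sq_add_I_ne_zero {w : ℂ} (hw : w ∈ closedQuadrant) : w ^ 2 + Complex.I ≠ 0 := by
  intro h
  have := congrArg Complex.im h
  simp [sq] at this
  nlinarith [mul_nonneg hw.1 hw.2]

/-- `w⁴+1 = (w-ζ)(w+ζ)(w²+i)`, and only the first factor vanishes in the quadrant. Dividing it into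
`H w - H ζ` leaves the left side, which is holomorphic at `ζ` too. -/
theorem two_mul_mul_dslope_eq {H : ℂ → ℂ} {w : ℂ} (hw : w ∈ closedQuadrant) (hne : w ≠ eighthRoot) :
    dslope H eighthRoot w * (2 * w) / ((w + eighthRoot) * (w ^ 2 + Complex.I)) =
      (H w - H eighthRoot) * (2 * w) / (w ^ 4 + 1) := by
  have e : w ^ 4 + 1 = (w - eighthRoot) * ((w + eighthRoot) * (w ^ 2 + Complex.I)) := by
    have : (w - eighthRoot) * ((w + eighthRoot) * (w ^ 2 + Complex.I)) =
      (w ^ 2 - eighthRoot ^ 2) * (w ^ 2 + Complex.I) := by ring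
    rw [this, eighthRoot_sq]
    linear_combination Complex.I_sq
  rw [dslope_of_ne _ hne, slope_def_field, e]
  have h1 := sub_ne_zero.2 hne
  have h2 := add_eighthRoot_ne_zero hw
  have h3 := sq_add_I_ne_zero hw
  field_simp

theorem integral_cauchyMeasure_re_eq {H : ℂ → ℂ} (hH : DifferentiableOn ℂ H closedQuadrant) {C : ℝ}
    (hC : ∀ w ∈ closedQuadrant, ‖H w‖ ≤ C * (1 + ‖w‖)) :
    ∫ x : ℝ, ((H (Real.sqrt |x|)).re + (H (Real.sqrt |x| * Complex.I)).re
      - 2 * (H eighthRoot).re) ∂(cauchyMeasure 0 1) = 0 := by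
  have hg : DifferentiableOn ℂ (fun w => dslope H eighthRoot w * (2 * w) /
      ((w + eighthRoot) * (w ^ 2 + Complex.I))) closedQuadrant := by
    have hd := (Complex.differentiableOn_dslope closedQuadrant_mem_nhds_eighthRoot).2 hH
    exact (hd.mul (by fun_prop)).div (by fun_prop)
      fun w hw => mul_ne_zero (add_eighthRoot_ne_zero hw) (sq_add_I_ne_zero hw)
  obtain ⟨i1, i2, h⟩ := integral_axes_eq_of_norm_le_div_sq hg
    (M := 4 * (2 * C + ‖H eighthRoot‖)) (fun w hw h2 => by
      have hne : w ≠ eighthRoot := by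
        rintro rfl
        have h1 : ‖eighthRoot‖ ^ 2 = 1 := by rw [← norm_pow, eighthRoot_sq, Complex.norm_I]
        nlinarith
      rw [two_mul_mul_dslope_eq hw hne]
      have hpos : 0 < ‖w‖ := by linarith
      have h4 : ‖w‖ ^ 4 / 2 ≤ ‖w ^ 4 + 1‖ := by
        have := norm_sub_le_norm_add (w ^ 4) 1
        rw [norm_pow, norm_one] at this
        have : (2 : ℝ) ^ 4 ≤ ‖w‖ ^ 4 := by gcongr
        linarith
      have hC0 : 0 ≤ C := by
        have := (norm_nonneg _).trans (hC w hw)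
        by_contra! hc
        nlinarith
      have hn : ‖H w - H eighthRoot‖ ≤ (2 * C + ‖H eighthRoot‖) * ‖w‖ := by
        refine (norm_sub_le _ _).trans ?_
        have := hC w hw
        nlinarith [norm_nonneg (H eighthRoot)]
      rw [norm_div, norm_mul, norm_mul, Complex.norm_two]
      calc ‖H w - H eighthRoot‖ * (2 * ‖w‖) / ‖w ^ 4 + 1‖
          ≤ ((2 * C + ‖H eighthRoot‖) * ‖w‖) * (2 * ‖w‖) / (‖w‖ ^ 4 / 2) := by gcongr
        _ = _ := by field_simp; ring)
  have hz := sub_eq_zero.2 h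
  rw [← integral_const_mul, ← integral_sub i1 (i2.const_mul _)] at hz
  have hz' := (ContinuousLinearMap.integral_comp_comm Complex.reCLM
    (i1.sub (i2.const_mul Complex.I))).trans (congrArg Complex.re hz)
  rw [integral_cauchyMeasure_comp_abs (fun x => (H (Real.sqrt x)).re +
    (H (Real.sqrt x * Complex.I)).re - 2 * (H eighthRoot).re), mul_eq_zero]
  right
  refine (setIntegral_congr_fun measurableSet_Ioi fun u hu => ?_).trans hz'
  have hu' : 0 ≤ u := le_of_lt hu
  simp only [Pi.sub_apply]
  rw [two_mul_mul_dslope_eq (ofReal_mem_closedQuadrant hu') (fun h => by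
      have := eighthRoot_im_pos
      simp [← h] at this),
    two_mul_mul_dslope_eq (ofReal_mul_I_mem_closedQuadrant hu') (fun h => by
      have := eighthRoot_re_pos
      simp [← h] at this), Real.sqrt_sq hu']
  -- `w⁴` agrees on both axes, while `i·(iu) = -u` turns the difference of axis integrands into a
  -- sum.
  have e2 : (H u - H eighthRoot) * (2 * u) / ((u : ℂ) ^ 4 + 1) - Complex.I *
      ((H (u * Complex.I) - H eighthRoot) * (2 * (u * Complex.I)) / ((u * Complex.I) ^ 4 + 1)) =
      ((2 * u / (u ^ 4 + 1) : ℝ) : ℂ) * (H u + H (u * Complex.I) - 2 * H eighthRoot) := by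
    rw [mul_pow, Complex.I_pow_four]
    push_cast
    linear_combination (-(H (u * Complex.I) - H eighthRoot) * (2 * u) / ((u : ℂ) ^ 4 + 1)) *
      Complex.I_sq
  rw [e2, Complex.reCLM_apply, Complex.re_ofReal_mul]
  simp
  ring

theorem integral_cauchyMeasure_re_add_re {H : ℂ → ℂ} (hH : DifferentiableOn ℂ H closedQuadrant)
    {C : ℝ} (hC : ∀ w ∈ closedQuadrant, ‖H w‖ ≤ C * (1 + ‖w‖)) {f : ℝ → ℝ} (hf : Measurable f)
    (hfH : ∀ x : ℝ, f x = (H (Real.sqrt |x|)).re + (H (Real.sqrt |x| * Complex.I)).re) :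
    Integrable f (cauchyMeasure 0 1) ∧
      ∫ x, f x ∂(cauchyMeasure 0 1) = 2 * (H eighthRoot).re := by
  have hi : Integrable f (cauchyMeasure 0 1) := by
    refine integrable_cauchyMeasure_of_abs_le hf (C := 2 * C) fun x => ?_
    have h1 := hC _ (ofReal_mem_closedQuadrant (Real.sqrt_nonneg |x|))
    have h2 := hC _ (ofReal_mul_I_mem_closedQuadrant (Real.sqrt_nonneg |x|))
    rw [norm_mul, Complex.norm_I, mul_one] at h2
    rw [Complex.norm_real, Real.norm_of_nonneg (Real.sqrt_nonneg _)] at h1 h2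
    rw [hfH]
    refine (abs_add_le _ _).trans ?_
    linarith [Complex.abs_re_le_norm (H (Real.sqrt |x|)),
      Complex.abs_re_le_norm (H (Real.sqrt |x| * Complex.I))]
  refine ⟨hi, ?_⟩
  have h := integral_cauchyMeasure_re_eq hH hC
  simp_rw [← hfH] at h
  rw [integral_sub hi (integrable_const _)] at h
  simp at h
  linarith

/-! ### The function `log(1 + cw)` -/

theorem one_add_ofReal_mul_re {c : ℝ} (hc : 0 ≤ c) {w : ℂ} (hw : w ∈ closedQuadrant) :
    1 ≤ (1 + c * w).re := by
  simpa using mul_nonneg hc hw.1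

theorem Complex.arg_eq_arctan_of_re_pos {z : ℂ} (hz : 0 < z.re) :
    z.arg = Real.arctan (z.im / z.re) := by
  have h := abs_lt.1 (Complex.abs_arg_lt_pi_div_two_iff.2 (Or.inl hz))
  rw [← Complex.tan_arg, Real.arctan_tan h.1 h.2]

/-- From `log y = 2 log √y ≤ 2(√y - 1)`. -/
theorem Real.sq_log_le {y : ℝ} (hy : 1 ≤ y) : Real.log y ^ 2 ≤ 4 * y := by
  have h0 := Real.log_nonneg hy
  have h1 := Real.log_le_sub_one_of_pos (Real.sqrt_pos.2 (by linarith : 0 < y))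
  rw [Real.log_sqrt (by linarith)] at h1
  have h2 := Real.sq_sqrt (by linarith : 0 ≤ y)
  have h3 := Real.sqrt_nonneg y
  nlinarith

section

variable {c : ℝ}

theorem differentiableOn_log_one_add_mul (hc : 0 ≤ c) :
    DifferentiableOn ℂ (fun w : ℂ => Complex.log (1 + c * w)) closedQuadrant := by
  refine DifferentiableOn.clog (by fun_prop) fun w hw => Or.inl ?_
  linarith [one_add_ofReal_mul_re hc hw]

/-- Linear growth of the square serves both choices of `H`, the logarithm and its square. -/
theorem norm_log_one_add_mul_sq_le (hc : 0 ≤ c) {w : ℂ} (hw : w ∈ closedQuadrant) :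
    ‖Complex.log (1 + c * w)‖ ^ 2 ≤ (4 * (1 + c) + Real.pi ^ 2) * (1 + ‖w‖) := by
  have hre := one_add_ofReal_mul_re hc hw
  have h1 : 1 ≤ ‖1 + c * w‖ := hre.trans ((le_abs_self _).trans (Complex.abs_re_le_norm _))
  have h2 : ‖1 + c * w‖ ≤ 1 + c * ‖w‖ := by
    refine (norm_add_le _ _).trans_eq ?_
    rw [norm_one, norm_mul, Complex.norm_real, Real.norm_of_nonneg hc]
  have h3 := Real.sq_log_le h1
  have h4 : (1 + c * w).arg ^ 2 ≤ Real.pi ^ 2 :=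
    sq_le_sq.2 ((Complex.abs_arg_le_pi _).trans (le_abs_self _))
  rw [← Complex.normSq_eq_norm_sq, Complex.normSq_apply, Complex.log_re, Complex.log_im]
  nlinarith [norm_nonneg w, mul_nonneg (sq_nonneg Real.pi) (norm_nonneg w)]

theorem log_one_add_mul_ofReal (hc : 0 ≤ c) {u : ℝ} (hu : 0 ≤ u) :
    Complex.log (1 + c * u) = (Real.log (1 + c * u) : ℝ) := by
  rw [Complex.ofReal_log (by positivity)]
  push_cast
  rfl

theorem log_one_add_mul_ofReal_mul_I_re (c u : ℝ) :
    (Complex.log (1 + c * (u * Complex.I))).re = 1 / 2 * Real.log (1 + c ^ 2 * u ^ 2) := by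
  rw [Complex.log_re, Complex.norm_def, Real.log_sqrt (Complex.normSq_nonneg _),
    Complex.normSq_apply]
  simp
  ring_nf

theorem log_one_add_mul_ofReal_mul_I_im (c u : ℝ) :
    (Complex.log (1 + c * (u * Complex.I))).im = Real.arctan (c * u) := by
  rw [Complex.log_im, Complex.arg_eq_arctan_of_re_pos (by simp)]
  simp

/-- With `c = a√2` the argument is `arctan(a/(1+a))`; double it, subtract `arctan(a - 1/(2a))` to
get `arctan(1/(2a²))`, and use `2a² = c²`. -/
theorem two_mul_log_one_add_mul_eighthRoot_im (hc : 0 < c) :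
    2 * (Complex.log (1 + c * eighthRoot)).im = hFun c - Real.arctan (c ^ 2) := by
  obtain ⟨a, ha, rfl⟩ : ∃ a, 0 < a ∧ c = a * Real.sqrt 2 :=
    ⟨c / Real.sqrt 2, by positivity, by field_simp⟩
  have h2 : Real.sqrt 2 ^ 2 = 2 := Real.sq_sqrt (by norm_num)
  have hs : Real.sqrt 2 ≠ 0 := by positivity
  have hre : (1 + ((a * Real.sqrt 2 : ℝ) : ℂ) * eighthRoot).re = 1 + a := by
    simp [eighthRoot, mul_assoc, hs]
  have him : (1 + ((a * Real.sqrt 2 : ℝ) : ℂ) * eighthRoot).im = a := by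
    simp [eighthRoot, mul_assoc, hs]
  rw [Complex.log_im, Complex.arg_eq_arctan_of_re_pos (by rw [hre]; linarith), hre, him, hFun,
    mul_pow, h2, mul_div_cancel_right₀ _ hs, mul_assoc, ← sq, h2]
  have hlt : a / (1 + a) < 1 := by rw [div_lt_one (by linarith)]; linarith
  have hne : 1 - (a / (1 + a)) ^ 2 ≠ 0 := by
    have : 0 < a / (1 + a) := by positivity
    nlinarith
  have e1 : 2 * Real.arctan (a / (1 + a)) = Real.arctan (2 * a * (1 + a) / (1 + 2 * a)) := by
    rw [Real.two_mul_arctan (by linarith [show 0 < a / (1 + a) by positivity]) hlt]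
    congr 1
    rw [div_eq_div_iff hne (by positivity)]
    field_simp
    ring
  have e2 : Real.arctan (2 * a * (1 + a) / (1 + 2 * a)) + Real.arctan (-(a - 1 / (a * 2))) =
      Real.arctan ((a ^ 2 * 2)⁻¹) := by
    -- Positivity of this quantity is the condition for the arctangent addition formula without a
    -- shift by `π`.
    have hl : 1 - 2 * a * (1 + a) / (1 + 2 * a) * -(a - 1 / (a * 2)) =
        a * (1 + 2 * a + 2 * a ^ 2) / (1 + 2 * a) := by
      field_simp
      ring
    have hp : 0 < a * (1 + 2 * a + 2 * a ^ 2) / (1 + 2 * a) := by positivity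
    rw [Real.arctan_add (by linarith), hl]
    congr 1
    field_simp
    ring
  rw [Real.arctan_inv_of_pos (by positivity), Real.arctan_neg] at e2
  linarith

theorem xi_sq_mul_abs (hc : 0 ≤ c) (x : ℝ) :
    xi (c ^ 2 * |x|) = (Complex.log (1 + c * Real.sqrt |x|)).re +
      (Complex.log (1 + c * (Real.sqrt |x| * Complex.I))).re := by
  rw [log_one_add_mul_ofReal hc (Real.sqrt_nonneg _), Complex.ofReal_re,
    log_one_add_mul_ofReal_mul_I_re, Real.sq_sqrt (abs_nonneg x), xi, Real.sqrt_mul (sq_nonneg c),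
    Real.sqrt_sq hc]

theorem sq_log_add_sq_log_sub_sq_arctan (hc : 0 ≤ c) (x : ℝ) :
    Real.log (1 + Real.sqrt (c ^ 2 * |x|)) ^ 2 + 1 / 4 * Real.log (1 + c ^ 2 * |x|) ^ 2
      - Real.arctan (Real.sqrt (c ^ 2 * |x|)) ^ 2 =
    (Complex.log (1 + c * Real.sqrt |x|) ^ 2).re +
      (Complex.log (1 + c * (Real.sqrt |x| * Complex.I)) ^ 2).re := by
  have hre : ∀ z : ℂ, (z ^ 2).re = z.re ^ 2 - z.im ^ 2 := fun z => by simp [sq]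
  rw [hre (Complex.log (1 + c * (Real.sqrt |x| * Complex.I))),
    log_one_add_mul_ofReal hc (Real.sqrt_nonneg _), hre, Complex.ofReal_re, Complex.ofReal_im,
    log_one_add_mul_ofReal_mul_I_re, log_one_add_mul_ofReal_mul_I_im,
    Real.sq_sqrt (abs_nonneg x), Real.sqrt_mul (sq_nonneg c), Real.sqrt_sq hc]
  ring

theorem integral_xi_cauchyMeasure (hc : 0 ≤ c) :
    Integrable (fun x => xi (c ^ 2 * |x|)) (cauchyMeasure 0 1) ∧
      ∫ x, xi (c ^ 2 * |x|) ∂(cauchyMeasure 0 1) =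
        2 * (Complex.log (1 + c * eighthRoot)).re := by
  refine integral_cauchyMeasure_re_add_re (H := fun w => Complex.log (1 + c * w))
    (C := 4 * (1 + c) + Real.pi ^ 2 + 1) (differentiableOn_log_one_add_mul hc) (fun w hw => ?_)
    (by unfold xi; fun_prop) (xi_sq_mul_abs hc)
  have := norm_log_one_add_mul_sq_le hc hw
  nlinarith [sq_nonneg (‖Complex.log (1 + c * w)‖ - 1), norm_nonneg w,
    norm_nonneg (Complex.log (1 + c * w))]

theorem integral_sq_log_cauchyMeasure (hc : 0 ≤ c) :
    Integrable (fun x => Real.log (1 + Real.sqrt (c ^ 2 * |x|)) ^ 2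
      + 1 / 4 * Real.log (1 + c ^ 2 * |x|) ^ 2
      - Real.arctan (Real.sqrt (c ^ 2 * |x|)) ^ 2) (cauchyMeasure 0 1) ∧
    ∫ x, (Real.log (1 + Real.sqrt (c ^ 2 * |x|)) ^ 2 + 1 / 4 * Real.log (1 + c ^ 2 * |x|) ^ 2
      - Real.arctan (Real.sqrt (c ^ 2 * |x|)) ^ 2) ∂(cauchyMeasure 0 1) =
        2 * (Complex.log (1 + c * eighthRoot) ^ 2).re := by
  refine integral_cauchyMeasure_re_add_re (H := fun w => Complex.log (1 + c * w) ^ 2)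
    (C := 4 * (1 + c) + Real.pi ^ 2) ((differentiableOn_log_one_add_mul hc).pow 2)
    (fun w hw => ?_) (by fun_prop) (sq_log_add_sq_log_sub_sq_arctan hc)
  rw [norm_pow]
  exact norm_log_one_add_mul_sq_le hc hw

theorem integrable_sq_arctan_cauchyMeasure (c : ℝ) :
    Integrable (fun x => Real.arctan (Real.sqrt (c ^ 2 * |x|)) ^ 2) (cauchyMeasure 0 1) := by
  refine integrable_cauchyMeasure_of_abs_le (by fun_prop) (C := (Real.pi / 2) ^ 2) fun x => ?_
  rw [abs_of_nonneg (sq_nonneg _)]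
  have h : Real.arctan (Real.sqrt (c ^ 2 * |x|)) ^ 2 ≤ (Real.pi / 2) ^ 2 := by
    refine sq_le_sq.2 (le_trans ?_ (le_abs_self _))
    exact abs_le.2 ⟨(Real.neg_pi_div_two_lt_arctan _).le, (Real.arctan_lt_pi_div_two _).le⟩
  nlinarith [mul_nonneg (sq_nonneg (Real.pi / 2)) (Real.sqrt_nonneg |x|)]

end

theorem mainTheorem3 {Ω : Type*} [MeasurableSpace Ω] (P : Measure Ω) (X : Ω → ℝ)
    (hX : HasLaw X (cauchyMeasure 0 1) P) (lam : ℝ) (hlam : 0 < lam) :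
    Integrable (fun ω => 2 * Real.log (1 + Real.sqrt (lam * |X ω|)) ^ 2
        + 1 / 2 * Real.log (1 + lam * |X ω|) ^ 2) P ∧
    Integrable (fun ω => Real.arctan (Real.sqrt (lam * |X ω|)) ^ 2) P ∧
    Integrable (fun ω => xi (lam * |X ω|)) P ∧
    ∫ ω, (2 * Real.log (1 + Real.sqrt (lam * |X ω|)) ^ 2
        + 1 / 2 * Real.log (1 + lam * |X ω|) ^ 2) ∂P
      = 2 * (∫ ω, Real.arctan (Real.sqrt (lam * |X ω|)) ^ 2 ∂P)
        + xiMean P X lam ^ 2 - Real.arctan lam ^ 2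
        + 2 * Real.arctan lam * hFun (Real.sqrt lam) - hFun (Real.sqrt lam) ^ 2 := by
  obtain ⟨c, hc, rfl⟩ : ∃ c, 0 < c ∧ lam = c ^ 2 :=
    ⟨Real.sqrt lam, Real.sqrt_pos.2 hlam, (Real.sq_sqrt hlam.le).symm⟩
  obtain ⟨i1, e1⟩ := integral_xi_cauchyMeasure hc.le
  obtain ⟨i2, e2⟩ := integral_sq_log_cauchyMeasure hc.le
  have i3 := integrable_sq_arctan_cauchyMeasure c
  have hsum : ∀ x : ℝ, 2 * Real.log (1 + Real.sqrt (c ^ 2 * |x|)) ^ 2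
      + 1 / 2 * Real.log (1 + c ^ 2 * |x|) ^ 2 =
      2 * (Real.log (1 + Real.sqrt (c ^ 2 * |x|)) ^ 2 + 1 / 4 * Real.log (1 + c ^ 2 * |x|) ^ 2
        - Real.arctan (Real.sqrt (c ^ 2 * |x|)) ^ 2) +
      2 * Real.arctan (Real.sqrt (c ^ 2 * |x|)) ^ 2 := fun x => by ring
  have i4 := (i2.const_mul 2).add (i3.const_mul 2)
  have e4 := integral_add (i2.const_mul 2) (i3.const_mul 2)
  rw [integral_const_mul, integral_const_mul, e2] at e4
  have hint : ∀ {f : ℝ → ℝ}, Integrable f (cauchyMeasure 0 1) → Integrable (fun ω => f (X ω)) P :=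
    fun {f} hf => by
      rw [← hX.map_eq] at hf
      exact hf.comp_aemeasurable hX.aemeasurable
  have heq : ∀ {f : ℝ → ℝ}, Integrable f (cauchyMeasure 0 1) →
      ∫ ω, f (X ω) ∂P = ∫ x, f x ∂(cauchyMeasure 0 1) :=
    fun {f} hf => hX.integral_comp hf.aestronglyMeasurable
  simp_rw [hsum]
  refine ⟨hint i4, hint i3, hint i1, ?_⟩
  have him := two_mul_log_one_add_mul_eighthRoot_im hc
  have hre : (Complex.log (1 + c * eighthRoot) ^ 2).re =
      (Complex.log (1 + c * eighthRoot)).re ^ 2 - (Complex.log (1 + c * eighthRoot)).im ^ 2 := by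
    simp [sq]
  rw [xiMean, heq i1, heq i3, e1, Real.sqrt_sq hc.le]
  refine ((heq i4).trans e4).trans ?_
  rw [hre]
  -- Difference of squares: `him` times the sum of its two sides gives `(2 Im L(ζ))² = (h(c) -
  -- arctan c²)²`.
  linear_combination (-(2 * (Complex.log (1 + c * eighthRoot)).im) -
    (hFun c - Real.arctan (c ^ 2))) * him
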